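/- Let $\mathcal D\subseteq\mathbb R^n$ be a nonempty closed convex set with $\|x-y\|\le D$ for all $x,y\in\mathcal D$, and let $d$ be the dimension of $\mathcal D$ (of its affine hull). Let $f_1,\dots,f_T:\mathcal D\to\mathbb R$ be differentiable losses that are $G$-Lipschitz on $\mathcal D$ and $\alpha$-exp-concave, i.e. $$f_t(y)\ge f_t(x)+\nabla f_t(x)^\top(y-x)+\tfrac{\alpha}{2}\bigl(\nabla f_t(x)^\top(y-x)\bigr)^2\qquad\text{for all }x,y\in\mathcal D,$$ where $\alpha,G,D>0$. Base learners (Online Newton Step): put $\beta=\frac12\min\{\frac1{4GD},\alpha\}$ and $\varepsilon=\frac1{\beta^2D^2}$. For each $j$, the base learner $j$ starts in round $j$ at an arbitrary point $x^{(j)}_j\in\mathcal D$ with $A^{(j)}_{j-1}=\varepsilon I$, and for $t\ge j$ it sets $g=\nabla f_t(x^{(j)}_t)$, $A^{(j)}_t=A^{(j)}_{t-1}+gg^\top$, and lets $x^{(j)}_{t+1}$ be the projection of $x^{(j)}_t-\frac1\beta (A^{(j)}_t)^{-1}g$ onto $\mathcal D$ in the norm $\|v\|=\sqrt{v^\top A^{(j)}_t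 v}$. Follow-the-Leading-History (FLH) with learning rate $\zeta=\alpha$ over these base learners: in round $t$ play $x_t=\sum_{j=1}^t v_t^{(j)}x_t^{(j)}$, where $v_1^{(1)}=1$, $v_{t+1}^{(t+1)}=\frac1{t+1}$, and, for $1\le i\le t$, $$v_{t+1}^{(i)}=\Bigl(1-\frac1{t+1}\Bigr)\frac{v_t^{(i)}e^{-\zeta f_t(x_t^{(i)})}}{\sum_{j=1}^t v_t^{(j)}e^{-\zeta f_t(x_t^{(j)})}}.$$ Then FLH has dynamic regret $\tilde O(\sqrt{dTV_T}\vee d)$, adaptively in $V_T$. That is, there are an absolute constant $k$ and a constant $C$ depending only on $\alpha,G,D$ such that, for all $n$, $\mathcal D$, $T\ge1$, all such losses and starting points, and every comparator sequence $z_1,\dots,z_T\in\mathcal D$, $$\sum_{t=1}^T\bigl(f_t(x_t)-f_t(z_t)\bigr)\le C\,(1+\log T)^k\,\max\Bigl\{\sqrt{d\,T\,V_T},\;d\Bigr\},\qquad V_T=\sum_{t=2}^T\|z_t-z_{t-1}\|.$$ -/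

import Mathlib

noncomputable section

section OnlineConvexOptimization

variable {E : Type*} [NormedAddCommGroup E] [InnerProductSpace ℝ E]

/-- `f` is `G`-Lipschitz on the decision set `S`. -/
def LossLipschitzOn (G : ℝ) (S : Set E) (f : E → ℝ) : Prop :=
  ∀ x ∈ S, ∀ y ∈ S, |f x - f y| ≤ G * ‖x - y‖

/-- `f`, with gradient `g` on `S`, is `α`-exp-concave on `S`:
`f y ≥ f x + ⟨∇f x, y - x⟩ + (α / 2) ⟨∇f x, y - x⟩²` for all `x, y` in `S`. -/
def ExpConcaveOn (α : ℝ) (S : Set E) (f : E → ℝ) (g : E → E) : Prop :=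
  ∀ x ∈ S, ∀ y ∈ S,
    f x + inner ℝ (g x) (y - x) + α / 2 * (inner ℝ (g x) (y - x)) ^ 2 ≤ f y

/-- `p` is a projection of `y` onto `S` in the norm `‖v‖_A = √⟨A v, v⟩`. -/
def IsGenProj (S : Set E) (A : E →L[ℝ] E) (y p : E) : Prop :=
  p ∈ S ∧ ∀ z ∈ S, inner ℝ (A (p - y)) (p - y) ≤ inner ℝ (A (z - y)) (z - y)

/-- The projection of `y` onto `S` in the norm induced by `A` (it exists and is unique when `A` is
positive definite and `S` is a nonempty compact convex set). -/
def genProj (S : Set E) (A : E →L[ℝ] E) (y : E) : E :=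
  Classical.epsilon (IsGenProj S A y)

/-- Online Newton Step on `S` with parameters `γ` and `ε`, started in round `j` at the point `x₁`,
where `grad t x` is the gradient at `x` of the loss of round `t`. The value at `k` is the state at
the beginning of round `j + k`: the point to be played and the matrix
`ε I + ∑ (past gradients) (past gradients)ᵀ`. -/
def onsState (S : Set E) (γ ε : ℝ) (grad : ℕ → E → E) (x₁ : E) (j : ℕ) :
    ℕ → E × (E →L[ℝ] E)
  | 0 => (x₁, ε • ContinuousLinearMap.id ℝ E)
  | k + 1 =>
    let x := (onsState S γ ε grad x₁ j k).1
    let g := grad (j + k) x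
    let A := (onsState S γ ε grad x₁ j k).2 + InnerProductSpace.rankOne ℝ g g
    (genProj S A (x - γ⁻¹ • A.inverse g), A)

/-- The prediction for round `t ≥ j` of Online Newton Step started in round `j`. -/
def onsPrediction (S : Set E) (γ ε : ℝ) (grad : ℕ → E → E) (x₁ : E) (j t : ℕ) : E :=
  (onsState S γ ε grad x₁ j (t - j)).1

/-- The standard parameter `β = (1 / 2) min {1 / (4 G D), α}` of Online Newton Step. -/
def onsRate (α G D : ℝ) : ℝ := 1 / 2 * min (1 / (4 * G * D)) α

/-- The standard regularization `ε = 1 / (β² D²)` of Online Newton Step. -/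
def onsReg (α G D : ℝ) : ℝ := 1 / (onsRate α G D ^ 2 * D ^ 2)

/-- The weights of Follow-the-Leading-History with learning rate `ζ`: `flhWeight ζ f x t i` is the
weight in round `t ≥ 1` of the base learner `1 ≤ i ≤ t`. Here `f t` is the loss of round `t`
and `x i t` is the prediction of base learner `i` for round `t`. -/
def flhWeight (ζ : ℝ) (f : ℕ → E → ℝ) (x : ℕ → ℕ → E) : ℕ → ℕ → ℝ
  | 0, _ => 0
  | 1, i => if i = 1 then 1 else 0
  | t + 2, i =>
    if i = t + 2 then 1 / ((t : ℝ) + 2)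
    else if i ∈ Finset.Icc 1 (t + 1) then
      (1 - 1 / ((t : ℝ) + 2)) *
        (flhWeight ζ f x (t + 1) i * Real.exp (-ζ * f (t + 1) (x i (t + 1))) /
          ∑ j ∈ Finset.Icc 1 (t + 1),
            flhWeight ζ f x (t + 1) j * Real.exp (-ζ * f (t + 1) (x j (t + 1))))
    else 0

/-- The point played in round `t` by Follow-the-Leading-History. -/
def flhPrediction (ζ : ℝ) (f : ℕ → E → ℝ) (x : ℕ → ℕ → E) (t : ℕ) : E :=
  ∑ j ∈ Finset.Icc 1 t, flhWeight ζ f x t j • x j t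

/-- Follow-the-Leading-History with learning rate `ζ = α` whose `j`-th base learner is Online
Newton Step started in round `j` at the point `x₁ j`. -/
def flhOns (α G D : ℝ) (S : Set E) (f : ℕ → E → ℝ) (grad : ℕ → E → E) (x₁ : ℕ → E) :
    ℕ → E :=
  flhPrediction α f fun j t =>
    onsPrediction S (onsRate α G D) (onsReg α G D) grad (x₁ j) j t

/-- The dynamic regret over rounds `1, …, T` of the plays `x` against the comparators `z`. -/
def dynamicRegret (f : ℕ → E → ℝ) (x z : ℕ → E) (T : ℕ) : ℝ :=
  ∑ t ∈ Finset.Icc 1 T, (f t (x t) - f t (z t))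

/-- The path variation `∑_{t = 2}^T ‖z_t - z_{t - 1}‖`. -/
def pathVariation (z : ℕ → E) (T : ℕ) : ℝ :=
  ∑ t ∈ Finset.Icc 2 T, ‖z t - z (t - 1)‖

end OnlineConvexOptimization

end

/-!
Exp-concavity enters twice. Integrating the quadratic lower bound along segments shows that
`exp (-α f)` lies below its tangents (`ExpConcaveOn.exp_le_tangent`), hence satisfies Jensen's
inequality (`ExpConcaveOn.sum_exp_le`). Therefore Follow-the-Leading-History with rate `α` has
regret at most `log (T + 1) / α` against each base learner since its start: the logarithm of the
weight of the learner is a potential (`flh_regret_le_log`). The quadratic term itself gives the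
Online Newton Step regret `O(d log T)` against a fixed point (`ons_regret`). Together, the regret
against a fixed point is `O(d log T)` on every interval (`flhOns_interval_regret`).

For a moving comparator, cut the horizon into blocks of length `L` and replace the comparator on
each block by its first point. This costs at most `G L V_T` in total, so the dynamic regret is at
most `(T / L + 1) O(d log T) + G L V_T` (`dynamicRegret_le_of_interval_regret`); the block length
`L = T` if `T V_T ≤ d`, and `L ≈ √(d T / V_T)` otherwise, gives the bound
(`le_max_of_forall_block_length`).

The dimension that enters is that of the affine hull of the decision set `S`, not that of the
ambient space. The gradient along `S` is determined, and bounded by `G`, only in its component in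
the direction space of `S`; the orthogonal component is arbitrary. The analysis of Online Newton
Step therefore never bounds the unprojected step. It uses the optimality condition of the
projection (`onsState_optimality`), which depends on that component alone, and a log-determinant
potential written in an orthonormal basis of the direction space (`ons_linearized_regret`).
-/

/-! ### Exp-concave and Lipschitz losses along a convex set -/

section ExpConcavity

open Set

/-- The scalar form of exp-concavity: a function on `[0, 1]` with the quadratic lower bounds
`h s ≥ h r + h' r (s - r) + (α / 2) (h' r (s - r))²` has `exp (-α h)` below its tangent at `0`. -/
lemma exp_neg_mul_le_tangent {α : ℝ} (hα : 0 < α) {h h' : ℝ → ℝ}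
    (hd : ∀ r ∈ Icc (0 : ℝ) 1, HasDerivWithinAt h (h' r) (Icc 0 1) r)
    (hq : ∀ r ∈ Icc (0 : ℝ) 1, ∀ s ∈ Icc (0 : ℝ) 1,
      h r + h' r * (s - r) + α / 2 * (h' r * (s - r)) ^ 2 ≤ h s) :
    Real.exp (-α * h 1) ≤ Real.exp (-α * h 0) * (1 - α * h' 0) := by
  set a := h' 0 with ha
  have h0 : (0 : ℝ) ∈ Icc (0 : ℝ) 1 := by simp
  -- Adding the two quadratic bounds between `0` and `r`, then AM-GM: where `h'` keeps its sign,
  -- `1 / h'` decreases at rate at least `α`.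
  have key : ∀ r ∈ Icc (0 : ℝ) 1, a ≤ h' r * (1 - α * a * r) := by
    intro r hr
    rcases hr.1.eq_or_lt with h0r | h0r
    · simp [← h0r, ha]
    · have h1 := hq 0 h0 r hr
      have h2 := hq r hr 0 h0
      have h3 : 0 ≤ r * (h' r - a - α * a * r * h' r) := by
        nlinarith [mul_nonneg hα.le (sq_nonneg (r * (h' r - a)))]
      have := nonneg_of_mul_nonneg_right h3 h0r
      linarith
  have hpos1 : 0 < 1 - α * a := by
    by_contra! hneg
    have hαa : 1 ≤ α * a := by linarith
    have ha0 : 0 < a := pos_of_mul_pos_right (by linarith) hα.le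
    have h1 : (1 : ℝ) ∈ Icc (0 : ℝ) 1 := by simp
    have h2 := key 1 h1
    have h3 := hq 0 h0 1 h1
    have h4 := hq 1 h1 0 h0
    have h5 : a ≤ h' 1 := by nlinarith [sq_nonneg a, sq_nonneg (h' 1)]
    nlinarith
  have hpos : ∀ r ∈ Icc (0 : ℝ) 1, 0 < 1 - α * a * r := by
    intro r hr
    rcases hr.2.eq_or_lt with h | h
    · subst h; simpa using hpos1
    · nlinarith [hr.1]
  have hkd : ∀ r ∈ Icc (0 : ℝ) 1, HasDerivWithinAt
      (fun r => h r + α⁻¹ * Real.log (1 - α * a * r))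
      (h' r + α⁻¹ * (-(α * a) / (1 - α * a * r))) (Icc 0 1) r := by
    intro r hr
    have hl : HasDerivAt (fun r : ℝ => 1 - α * a * r) (-(α * a)) r := by
      simpa using ((hasDerivAt_id r).const_mul (α * a)).const_sub 1
    exact (hd r hr).add ((hl.log (hpos r hr).ne').const_mul α⁻¹).hasDerivWithinAt
  have hkd' : ∀ r ∈ interior (Icc (0 : ℝ) 1), HasDerivAt
      (fun r => h r + α⁻¹ * Real.log (1 - α * a * r))
      (h' r + α⁻¹ * (-(α * a) / (1 - α * a * r))) r := fun r hr =>
    (hkd r (interior_subset hr)).hasDerivAt (mem_interior_iff_mem_nhds.1 hr)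
  have hmono : MonotoneOn (fun r => h r + α⁻¹ * Real.log (1 - α * a * r)) (Icc 0 1) := by
    refine monotoneOn_of_deriv_nonneg (convex_Icc 0 1)
      (fun r hr => (hkd r hr).continuousWithinAt)
      (fun r hr => (hkd' r hr).differentiableAt.differentiableWithinAt) fun r hr => ?_
    rw [(hkd' r hr).deriv]
    have hp := hpos r (interior_subset hr)
    have h2 := key r (interior_subset hr)
    have : h' r + α⁻¹ * (-(α * a) / (1 - α * a * r)) =
        (h' r * (1 - α * a * r) - a) / (1 - α * a * r) := by
      field_simp
      ring
    rw [this]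
    exact div_nonneg (by linarith) hp.le
  have hle := hmono h0 (right_mem_Icc.2 zero_le_one) zero_le_one
  simp only [mul_zero, sub_zero, Real.log_one, add_zero, mul_one] at hle
  calc Real.exp (-α * h 1) ≤ Real.exp (-α * h 0 + Real.log (1 - α * a)) := by
        refine Real.exp_le_exp.2 ?_
        have := mul_le_mul_of_nonneg_left hle hα.le
        rw [mul_add, mul_inv_cancel_left₀ hα.ne'] at this
        linarith
    _ = _ := by rw [Real.exp_add, Real.exp_log hpos1]

variable {E : Type*} [NormedAddCommGroup E] [InnerProductSpace ℝ E] [CompleteSpace E]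

lemma hasDerivWithinAt_segment {S : Set E} (hS : Convex ℝ S) {f : E → ℝ} {g : E → E}
    (hf : ∀ x ∈ S, HasGradientWithinAt f (g x) S x) {x y : E} (hx : x ∈ S) (hy : y ∈ S)
    {r : ℝ} (hr : r ∈ Icc (0 : ℝ) 1) :
    HasDerivWithinAt (fun r : ℝ => f (x + r • (y - x))) (inner ℝ (g (x + r • (y - x))) (y - x))
      (Icc 0 1) r := by
  have hmaps : MapsTo (fun r : ℝ => x + r • (y - x)) (Icc 0 1) S := fun r hr =>
    hS.add_smul_sub_mem hx hy hr
  have h1 : HasDerivWithinAt (fun r : ℝ => x + r • (y - x)) (y - x) (Icc 0 1) r := by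
    simpa using (((hasDerivAt_id r).smul_const (y - x)).const_add x).hasDerivWithinAt
  exact (hf _ (hmaps hr)).hasFDerivWithinAt.comp_hasDerivWithinAt r h1 hmaps

/-- If `f` is `α`-exp-concave, then `exp (-α f)` lies below its tangents. -/
lemma ExpConcaveOn.exp_le_tangent {α : ℝ} (hα : 0 < α) {S : Set E} (hS : Convex ℝ S) {f : E → ℝ}
    {g : E → E} (hf : ∀ x ∈ S, HasGradientWithinAt f (g x) S x) (hc : ExpConcaveOn α S f g)
    {x y : E} (hx : x ∈ S) (hy : y ∈ S) :
    Real.exp (-α * f y) ≤ Real.exp (-α * f x) * (1 - α * inner ℝ (g x) (y - x)) := by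
  have hmem : ∀ r ∈ Icc (0 : ℝ) 1, x + r • (y - x) ∈ S := fun r hr =>
    hS.add_smul_sub_mem hx hy hr
  have := exp_neg_mul_le_tangent hα (h := fun r : ℝ => f (x + r • (y - x)))
    (h' := fun r => inner ℝ (g (x + r • (y - x))) (y - x))
    (fun r hr => hasDerivWithinAt_segment hS hf hx hy hr) (fun r hr s hs => by
      have h1 := hc _ (hmem r hr) _ (hmem s hs)
      have h2 : x + s • (y - x) - (x + r • (y - x)) = (s - r) • (y - x) := by
        rw [sub_smul]; abel
      rw [h2, inner_smul_right, mul_comm (s - r)] at h1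
      exact h1)
  simpa using this

/-- **Mixability** of exp-concave losses: Jensen's inequality for `exp (-α f)`. -/
lemma ExpConcaveOn.sum_exp_le {α : ℝ} (hα : 0 < α) {S : Set E} (hS : Convex ℝ S) {f : E → ℝ}
    {g : E → E} (hf : ∀ x ∈ S, HasGradientWithinAt f (g x) S x) (hc : ExpConcaveOn α S f g)
    {ι : Type*} {s : Finset ι} {w : ι → ℝ} {p : ι → E} (hw : ∀ i ∈ s, 0 ≤ w i)
    (hw1 : ∑ i ∈ s, w i = 1) (hp : ∀ i ∈ s, p i ∈ S) :
    ∑ i ∈ s, w i * Real.exp (-α * f (p i)) ≤ Real.exp (-α * f (∑ i ∈ s, w i • p i)) := by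
  set x := ∑ i ∈ s, w i • p i with hxdef
  have hx : x ∈ S := hS.sum_mem hw hw1 hp
  have h0 : ∑ i ∈ s, w i * inner ℝ (g x) (p i - x) = 0 := by
    have : ∑ i ∈ s, w i • (p i - x) = 0 := by
      simp only [smul_sub, Finset.sum_sub_distrib, ← Finset.sum_smul, hw1, one_smul, ← hxdef,
        sub_self]
    calc _ = inner ℝ (g x) (∑ i ∈ s, w i • (p i - x)) := by
          simp [inner_sum, inner_smul_right]
      _ = 0 := by rw [this, inner_zero_right]
  calc _ ≤ ∑ i ∈ s, w i * (Real.exp (-α * f x) * (1 - α * inner ℝ (g x) (p i - x))) :=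
        Finset.sum_le_sum fun i hi =>
          mul_le_mul_of_nonneg_left (hc.exp_le_tangent hα hS hf hx (hp i hi)) (hw i hi)
    _ = Real.exp (-α * f x) * (∑ i ∈ s, w i - α * ∑ i ∈ s, w i * inner ℝ (g x) (p i - x)) := by
        rw [Finset.mul_sum, ← Finset.sum_sub_distrib, Finset.mul_sum]
        exact Finset.sum_congr rfl fun i _ => by ring
    _ = _ := by rw [hw1, h0]; ring

/-- The Lipschitz constant bounds the gradient on differences of feasible points. -/
lemma LossLipschitzOn.inner_grad_le {G : ℝ} {S : Set E} (hS : Convex ℝ S) {f : E → ℝ}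
    {g : E → E} (hf : ∀ x ∈ S, HasGradientWithinAt f (g x) S x) (hL : LossLipschitzOn G S f)
    {x y z : E} (hx : x ∈ S) (hy : y ∈ S) (hz : z ∈ S) :
    inner ℝ (g x) (y - z) ≤ G * ‖y - z‖ := by
  have h0 : (0 : ℝ) ∈ Icc (0 : ℝ) 1 := by simp
  have hd := (hasDerivWithinAt_segment hS hf hx hy h0).sub
    (hasDerivWithinAt_segment hS hf hx hz h0)
  have heq : inner ℝ (g (x + (0 : ℝ) • (y - x))) (y - x) -
      inner ℝ (g (x + (0 : ℝ) • (z - x))) (z - x) = inner ℝ (g x) (y - z) := by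
    simp [← inner_sub_right]
  rw [heq] at hd
  have ht := (hasDerivWithinAt_iff_tendsto_slope' (by simp)).1 (hd.mono Ioo_subset_Icc_self)
  rw [nhdsWithin_Ioo_eq_nhdsGT zero_lt_one] at ht
  refine le_of_tendsto ht ?_
  filter_upwards [Ioo_mem_nhdsGT (zero_lt_one (α := ℝ))] with r hr
  have hrI := Ioo_subset_Icc_self hr
  have hb := (abs_le.1 (hL _ (hS.add_smul_sub_mem hx hy hrI) _ (hS.add_smul_sub_mem hx hz hrI))).2
  have h2 : x + r • (y - x) - (x + r • (z - x)) = r • (y - z) := by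
    simp only [smul_sub]; abel
  rw [h2, norm_smul, Real.norm_of_nonneg hr.1.le] at hb
  rw [slope_def_field]
  simp only [Pi.sub_apply, zero_smul, add_zero, sub_self, sub_zero]
  rw [div_le_iff₀ hr.1]
  linarith

/-- Directions of a convex set are multiples of differences of its points. -/
lemma exists_smul_sub_of_mem_vectorSpan {F : Type*} [AddCommGroup F] [Module ℝ F] {S : Set F}
    (hS : Convex ℝ S) (hne : S.Nonempty) {v : F} (hv : v ∈ vectorSpan ℝ S) :
    ∃ c : ℝ, 0 ≤ c ∧ ∃ y ∈ S, ∃ z ∈ S, v = c • (y - z) := by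
  obtain ⟨o, ho⟩ := hne
  induction hv using Submodule.span_induction with
  | mem v hv =>
    obtain ⟨y, hy, z, hz, rfl⟩ := hv
    exact ⟨1, zero_le_one, y, hy, z, hz, by simp⟩
  | zero => exact ⟨0, le_rfl, o, ho, o, ho, by simp⟩
  | add v w _ _ hv hw =>
    obtain ⟨a, ha, y, hy, z, hz, rfl⟩ := hv
    obtain ⟨b, hb, y', hy', z', hz', rfl⟩ := hw
    rcases (add_nonneg ha hb).eq_or_lt with h | h
    · have ha0 : a = 0 := by linarith
      have hb0 : b = 0 := by linarith
      exact ⟨0, le_rfl, o, ho, o, ho, by simp [ha0, hb0]⟩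
    · refine ⟨a + b, h.le, (a / (a + b)) • y + (b / (a + b)) • y',
        hS hy hy' (by positivity) (by positivity) (by field_simp),
        (a / (a + b)) • z + (b / (a + b)) • z',
        hS hz hz' (by positivity) (by positivity) (by field_simp), ?_⟩
      simp only [smul_sub, smul_add, smul_smul, mul_div_cancel₀ _ h.ne']
      abel
  | smul t v _ hv =>
    obtain ⟨a, ha, y, hy, z, hz, rfl⟩ := hv
    rcases le_total 0 t with ht | ht
    · exact ⟨t * a, mul_nonneg ht ha, y, hy, z, hz, by rw [smul_smul]⟩
    · refine ⟨-t * a, mul_nonneg (by linarith) ha, z, hz, y, hy, ?_⟩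
      rw [smul_smul, neg_mul, neg_smul, ← smul_neg, neg_sub]

/-- Within the direction space of the decision set the gradient has norm at most `G`; its
component orthogonal to that space is not determined by the loss and can be arbitrarily large. -/
lemma LossLipschitzOn.inner_grad_le_of_mem_vectorSpan {G : ℝ} {S : Set E} (hS : Convex ℝ S)
    {f : E → ℝ} {g : E → E} (hf : ∀ x ∈ S, HasGradientWithinAt f (g x) S x)
    (hL : LossLipschitzOn G S f) {x v : E} (hx : x ∈ S) (hv : v ∈ vectorSpan ℝ S) :
    inner ℝ (g x) v ≤ G * ‖v‖ := by
  obtain ⟨c, hc, y, hy, z, hz, rfl⟩ := exists_smul_sub_of_mem_vectorSpan hS ⟨x, hx⟩ hv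
  rw [inner_smul_right, norm_smul, Real.norm_of_nonneg hc]
  have := mul_le_mul_of_nonneg_left (hL.inner_grad_le hS hf hx hy hz) hc
  linarith

end ExpConcavity

/-! ### The log-determinant potential -/

section LogDet

open Matrix

variable {d : ℕ}

/-- The matrix `ε I + ∑_{i < k} aᵢ aᵢᵀ`. -/
noncomputable def regGram (ε : ℝ) (a : ℕ → Fin d → ℝ) (k : ℕ) : Matrix (Fin d) (Fin d) ℝ :=
  ε • 1 + ∑ i ∈ Finset.range k, vecMulVec (a i) (a i)

lemma regGram_succ (ε : ℝ) (a : ℕ → Fin d → ℝ) (k : ℕ) :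
    regGram ε a (k + 1) = regGram ε a k + vecMulVec (a k) (a k) := by
  rw [regGram, Finset.sum_range_succ, ← add_assoc, regGram]

lemma dotProduct_regGram_mulVec (ε : ℝ) (a : ℕ → Fin d → ℝ) (k : ℕ) (w : Fin d → ℝ) :
    w ⬝ᵥ (regGram ε a k *ᵥ w) = ε * (w ⬝ᵥ w) + ∑ i ∈ Finset.range k, (a i ⬝ᵥ w) ^ 2 := by
  simp only [regGram, add_mulVec, smul_mulVec, one_mulVec, sum_mulVec, dotProduct_add,
    dotProduct_smul, dotProduct_sum, vecMulVec_mulVec, smul_eq_mul]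
  congr 1
  refine Finset.sum_congr rfl fun i _ => ?_
  simp [dotProduct_comm w (a i), sq]

lemma regGram_posDef {ε : ℝ} (hε : 0 < ε) (a : ℕ → Fin d → ℝ) (k : ℕ) :
    (regGram ε a k).PosDef := by
  refine (PosDef.one.smul hε).add_posSemidef (posSemidef_sum _ fun i _ => ?_)
  simpa using posSemidef_vecMulVec_self_star (a i)

/-- The matrix determinant lemma turns the norm of the new vector in the updated inverse
metric into a decrement of log-determinants. -/
lemma dotProduct_inv_mulVec_le_log_det {ε : ℝ} (hε : 0 < ε) (a : ℕ → Fin d → ℝ) (k : ℕ) :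
    a k ⬝ᵥ ((regGram ε a (k + 1))⁻¹ *ᵥ a k) ≤
      Real.log (regGram ε a (k + 1)).det - Real.log (regGram ε a k).det := by
  have hM := regGram_posDef hε a (k + 1)
  have hN := (regGram_posDef hε a k).det_pos
  have hdet : (regGram ε a k).det =
      (regGram ε a (k + 1)).det * (1 - a k ⬝ᵥ ((regGram ε a (k + 1))⁻¹ *ᵥ a k)) := by
    have h1 : regGram ε a k = regGram ε a (k + 1) +
        replicateCol Unit (-a k) * replicateRow Unit (a k) := by
      rw [regGram_succ, ← vecMulVec_eq, neg_vecMulVec]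
      abel
    conv_lhs => rw [h1]
    rw [det_add_replicateCol_mul_replicateRow (isUnit_iff_ne_zero.2 hM.det_pos.ne')]
    congr 1
    rw [det_unique]
    simp [Matrix.mul_assoc, Matrix.mul_apply, replicateRow, replicateCol, dotProduct, mulVec,
      Finset.sum_neg_distrib, sub_eq_add_neg]
  have hq : 0 < (regGram ε a (k + 1)).det / (regGram ε a k).det := div_pos hM.det_pos hN
  have := Real.one_sub_inv_le_log_of_pos hq
  rw [Real.log_div hM.det_pos.ne' hN.ne', inv_div] at this
  refine le_trans (le_of_eq ?_) this
  rw [hdet, mul_div_cancel_left₀ _ hM.det_pos.ne']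
  ring

/-- The progress of one step, maximized over all displacements `w`, is paid for by the growth of the
log-determinant. -/
lemma linear_sub_quadratic_le_log_det {ε : ℝ} (hε : 0 < ε) (a : ℕ → Fin d → ℝ) (k : ℕ) (c : ℝ)
    (w : Fin d → ℝ) :
    2 * c * (a k ⬝ᵥ w) - (ε * (w ⬝ᵥ w) + ∑ i ∈ Finset.range (k + 1), (a i ⬝ᵥ w) ^ 2) ≤
      c ^ 2 * (Real.log (regGram ε a (k + 1)).det - Real.log (regGram ε a k).det) := by
  rw [← dotProduct_regGram_mulVec]
  refine le_trans ?_ (mul_le_mul_of_nonneg_left (dotProduct_inv_mulVec_le_log_det hε a k)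
    (sq_nonneg c))
  have hM := regGram_posDef hε a (k + 1)
  set M := regGram ε a (k + 1)
  set h := M⁻¹ *ᵥ a k with hh
  have hMh : M *ᵥ h = a k := by
    rw [hh, mulVec_mulVec, mul_nonsing_inv _ (isUnit_iff_ne_zero.2 hM.det_pos.ne'), one_mulVec]
  have hsymm : h ⬝ᵥ (M *ᵥ w) = a k ⬝ᵥ w := by
    have hT : Mᵀ = M := by simpa using hM.isHermitian.eq
    rw [dotProduct_mulVec, ← mulVec_transpose, hT, hMh]
  -- Completing the square around the maximizer `c M⁻¹ a`.
  have hnn := hM.posSemidef.dotProduct_mulVec_nonneg (w - c • h)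
  simp only [star_trivial, mulVec_sub, mulVec_smul, hMh, dotProduct_sub, sub_dotProduct,
    smul_dotProduct, dotProduct_smul, smul_eq_mul, hsymm] at hnn
  rw [dotProduct_comm w (a k), dotProduct_comm h (a k)] at hnn
  nlinarith

lemma log_det_regGram_zero {ε : ℝ} (a : ℕ → Fin d → ℝ) :
    Real.log (regGram ε a 0).det = d * Real.log ε := by
  simp [regGram]

lemma log_det_regGram_le {ε G : ℝ} (hε : 0 < ε) (a : ℕ → Fin d → ℝ) (k : ℕ)
    (ha : ∀ i < k, a i ⬝ᵥ a i ≤ G ^ 2) :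
    Real.log (regGram ε a k).det ≤ d * Real.log (ε + k * G ^ 2) := by
  have hM := regGram_posDef hε a k
  have hpos : 0 < ε + k * G ^ 2 := by positivity
  have heig : ∀ i, hM.isHermitian.eigenvalues i ≤ ε + k * G ^ 2 := by
    intro i
    rw [hM.isHermitian.eigenvalues_eq]
    set w : Fin d → ℝ := ⇑(hM.isHermitian.eigenvectorBasis i) with hw
    have hw1 : w ⬝ᵥ w = 1 := by
      have h1 : inner ℝ (hM.isHermitian.eigenvectorBasis i)
          (hM.isHermitian.eigenvectorBasis i) = (1 : ℝ) := by
        rw [real_inner_self_eq_norm_sq, OrthonormalBasis.norm_eq_one, one_pow]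
      rw [EuclideanSpace.inner_eq_star_dotProduct] at h1
      simpa using h1
    have hb : ∑ j ∈ Finset.range k, (a j ⬝ᵥ w) ^ 2 ≤ k * G ^ 2 := by
      calc _ ≤ ∑ j ∈ Finset.range k, G ^ 2 := Finset.sum_le_sum fun j hj => by
            have hcs : (a j ⬝ᵥ w) ^ 2 ≤ (a j ⬝ᵥ a j) * (w ⬝ᵥ w) := by
              simpa [dotProduct, sq] using Finset.sum_mul_sq_le_sq_mul_sq Finset.univ (a j) w
            rw [hw1, mul_one] at hcs
            exact hcs.trans (ha j (Finset.mem_range.1 hj))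
        _ = _ := by simp
    simp only [star_trivial, RCLike.re_to_real]
    rw [dotProduct_regGram_mulVec, hw1]
    linarith
  calc Real.log (regGram ε a k).det ≤ Real.log ((ε + k * G ^ 2) ^ d) := by
        refine Real.log_le_log hM.det_pos ?_
        rw [hM.isHermitian.det_eq_prod_eigenvalues]
        simp only [RCLike.ofReal_real_eq_id, id]
        refine (Finset.prod_le_prod (fun i _ => (hM.eigenvalues_pos i).le)
          fun i _ => heig i).trans ?_
        simp
    _ = _ := Real.log_pow _ _

end LogDet

/-! ### Linearized regret of Online Newton Step -/

section OnlineNewtonStep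

variable {E : Type*} [NormedAddCommGroup E] [InnerProductSpace ℝ E]

lemma isGenProj_genProj {S : Set E} (hS : IsCompact S) (hne : S.Nonempty) (A : E →L[ℝ] E)
    (y : E) : IsGenProj S A y (genProj S A y) := by
  obtain ⟨p, hp, hmin⟩ := hS.exists_isMinOn hne
    (f := fun p => inner ℝ (A (p - y)) (p - y)) (by fun_prop)
  exact Classical.epsilon_spec (p := IsGenProj S A y) ⟨p, hp, fun z hz => hmin hz⟩

/-- The first-order optimality condition of the generalized projection. -/
lemma IsGenProj.inner_nonneg {S : Set E} (hS : Convex ℝ S) {A : E →L[ℝ] E}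
    (hA : ∀ v w, inner ℝ (A v) w = inner ℝ (A w) v) {y p u : E} (h : IsGenProj S A y p)
    (hu : u ∈ S) : 0 ≤ inner ℝ (A (p - y)) (u - p) := by
  by_contra! hneg
  set c := inner ℝ (A (p - y)) (u - p) with hc
  set q := inner ℝ (A (u - p)) (u - p) with hq
  have hr : ∀ r ∈ Set.Icc (0 : ℝ) 1, 0 ≤ r * (2 * c + r * q) := by
    intro r hr
    have h1 := h.2 _ (hS.add_smul_sub_mem h.1 hu hr)
    have h2 : p + r • (u - p) - y = (p - y) + r • (u - p) := by abel
    rw [h2, map_add, map_smul, inner_add_left, inner_add_right, inner_add_right,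
      inner_smul_right, real_inner_smul_left, real_inner_smul_left, inner_smul_right,
      hA (u - p) (p - y), ← hc, ← hq] at h1
    linarith
  -- A step short enough for the linear term to dominate decreases the objective.
  set r := min 1 (-c / (|q| + 1)) with hrdef
  have hr0 : 0 < r := lt_min one_pos (div_pos (by linarith) (by positivity))
  have h3 := nonneg_of_mul_nonneg_right (hr r ⟨hr0.le, min_le_left _ _⟩) hr0
  have h4 : r * (|q| + 1) ≤ -c := (le_div_iff₀ (by positivity)).1 (min_le_right _ _)
  have h5 : r * q ≤ r * |q| := mul_le_mul_of_nonneg_left (le_abs_self q) hr0.le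
  linarith

/-- The gradient that Online Newton Step started in round `j` observes in its `k`-th step. -/
noncomputable def onsGrad (S : Set E) (γ ε : ℝ) (grad : ℕ → E → E) (x₁ : E) (j k : ℕ) : E :=
  grad (j + k) (onsState S γ ε grad x₁ j k).1

lemma onsState_succ_snd (S : Set E) (γ ε : ℝ) (grad : ℕ → E → E) (x₁ : E) (j k : ℕ) :
    (onsState S γ ε grad x₁ j (k + 1)).2 = (onsState S γ ε grad x₁ j k).2 +
      InnerProductSpace.rankOne ℝ (onsGrad S γ ε grad x₁ j k) (onsGrad S γ ε grad x₁ j k) := rfl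

lemma onsState_succ_fst (S : Set E) (γ ε : ℝ) (grad : ℕ → E → E) (x₁ : E) (j k : ℕ) :
    (onsState S γ ε grad x₁ j (k + 1)).1 =
      genProj S (onsState S γ ε grad x₁ j (k + 1)).2 ((onsState S γ ε grad x₁ j k).1 -
        γ⁻¹ • (onsState S γ ε grad x₁ j (k + 1)).2.inverse (onsGrad S γ ε grad x₁ j k)) := rfl

lemma inner_onsState_snd (S : Set E) (γ ε : ℝ) (grad : ℕ → E → E) (x₁ : E) (j k : ℕ)
    (v w : E) :
    inner ℝ ((onsState S γ ε grad x₁ j k).2 v) w = ε * inner ℝ v w +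
      ∑ i ∈ Finset.range k, inner ℝ (onsGrad S γ ε grad x₁ j i) v *
        inner ℝ (onsGrad S γ ε grad x₁ j i) w := by
  induction k with
  | zero => simp [onsState, real_inner_smul_left]
  | succ k ih =>
    rw [onsState_succ_snd, add_apply, inner_add_left, ih,
      Finset.sum_range_succ, InnerProductSpace.rankOne_apply, real_inner_smul_left, add_assoc]

lemma inner_onsState_snd_comm (S : Set E) (γ ε : ℝ) (grad : ℕ → E → E) (x₁ : E) (j k : ℕ)
    (v w : E) :
    inner ℝ ((onsState S γ ε grad x₁ j k).2 v) w =
      inner ℝ ((onsState S γ ε grad x₁ j k).2 w) v := by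
  simp only [inner_onsState_snd, real_inner_comm v w]
  congr 1
  exact Finset.sum_congr rfl fun i _ => mul_comm _ _

lemma isInvertible_onsState_snd [FiniteDimensional ℝ E] (S : Set E) (γ : ℝ) {ε : ℝ}
    (hε : 0 < ε) (grad : ℕ → E → E) (x₁ : E) (j k : ℕ) :
    (onsState S γ ε grad x₁ j k).2.IsInvertible := by
  set A := (onsState S γ ε grad x₁ j k).2 with hA
  have hinj : Function.Injective A.toLinearMap := by
    rw [← LinearMap.ker_eq_bot, LinearMap.ker_eq_bot']
    intro v hv
    have h1 : inner ℝ (A v) v = 0 := by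
      rw [show A v = 0 from hv, inner_zero_left]
    rw [hA, inner_onsState_snd, real_inner_self_eq_norm_sq] at h1
    have h2 : 0 ≤ ∑ i ∈ Finset.range k, inner ℝ (onsGrad S γ ε grad x₁ j i) v *
        inner ℝ (onsGrad S γ ε grad x₁ j i) v :=
      Finset.sum_nonneg fun i _ => mul_self_nonneg _
    have h3 : ε * ‖v‖ ^ 2 = 0 := le_antisymm (by linarith) (by positivity)
    simpa [hε.ne'] using h3
  exact ⟨(LinearEquiv.ofInjectiveEndo A.toLinearMap hinj).toContinuousLinearEquiv, by
    ext v; simp⟩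

lemma onsState_fst_mem {S : Set E} (hS : IsCompact S) (γ ε : ℝ) (grad : ℕ → E → E) {x₁ : E}
    (hx₁ : x₁ ∈ S) (j k : ℕ) : (onsState S γ ε grad x₁ j k).1 ∈ S := by
  cases k with
  | zero => exact hx₁
  | succ k => exact (isGenProj_genProj hS ⟨x₁, hx₁⟩ _ _).1

/-- The optimality condition of an Online Newton Step. It involves the gradient only through its
values on differences of points of `S`, so that only its component in the direction space of `S`
matters. -/
lemma onsState_optimality [FiniteDimensional ℝ E] {S : Set E} (hS : IsCompact S)
    (hconv : Convex ℝ S) (γ : ℝ) {ε : ℝ} (hε : 0 < ε) (grad : ℕ → E → E) {x₁ : E} (hx₁ : x₁ ∈ S)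
    (j k : ℕ) {u : E} (hu : u ∈ S) :
    0 ≤ inner ℝ ((onsState S γ ε grad x₁ j (k + 1)).2
        ((onsState S γ ε grad x₁ j (k + 1)).1 - (onsState S γ ε grad x₁ j k).1))
        (u - (onsState S γ ε grad x₁ j (k + 1)).1) +
      γ⁻¹ * inner ℝ (onsGrad S γ ε grad x₁ j k) (u - (onsState S γ ε grad x₁ j (k + 1)).1) := by
  have hp := isGenProj_genProj hS ⟨x₁, hx₁⟩ (onsState S γ ε grad x₁ j (k + 1)).2
    ((onsState S γ ε grad x₁ j k).1 -
        γ⁻¹ • (onsState S γ ε grad x₁ j (k + 1)).2.inverse (onsGrad S γ ε grad x₁ j k))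
  rw [← onsState_succ_fst] at hp
  have := hp.inner_nonneg hconv (inner_onsState_snd_comm S γ ε grad x₁ j (k + 1)) hu
  rw [sub_sub_eq_add_sub, add_sub_right_comm, map_add, map_smul,
    (isInvertible_onsState_snd S γ hε grad x₁ j (k + 1)).self_apply_inverse, inner_add_left,
    real_inner_smul_left] at this
  exact this

/-- Inner products with a vector of `V` in the coordinates of an orthonormal basis of `V`; the other
factor `g` need not lie in `V`, and enters through its projection to `V`. -/
lemma exists_coord_of_mem {V : Submodule ℝ E} {d : ℕ} (b : OrthonormalBasis (Fin d) ℝ V) {w : E}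
    (hw : w ∈ V) : ∃ c : Fin d → ℝ,
      (∀ g : E, inner ℝ g w = (fun l => inner ℝ g (b l : E)) ⬝ᵥ c) ∧ ‖w‖ ^ 2 = c ⬝ᵥ c := by
  refine ⟨fun l => inner ℝ (b l) (⟨w, hw⟩ : V), fun g => ?_, ?_⟩
  · have h := congrArg (Submodule.subtype V) (b.sum_repr' ⟨w, hw⟩)
    simp only [map_sum, map_smul, Submodule.subtype_apply] at h
    conv_lhs => rw [← h]
    simp [inner_sum, inner_smul_right, dotProduct, mul_comm]
  · have h := b.sum_sq_norm_inner_right ⟨w, hw⟩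
    simp only [Real.norm_eq_abs, sq_abs, Submodule.coe_norm] at h
    simp only [dotProduct, ← sq]
    exact h.symm

/-- A linear bound on `V` bounds the norm of the projection of `g` to `V`, in coordinates. -/
lemma dotProduct_coord_le {V : Submodule ℝ E} {d : ℕ} (b : OrthonormalBasis (Fin d) ℝ V) {g : E}
    {G : ℝ} (hg : ∀ v ∈ V, inner ℝ g v ≤ G * ‖v‖) :
    (fun l => inner ℝ g (b l : E)) ⬝ᵥ (fun l => inner ℝ g (b l : E)) ≤ G ^ 2 := by
  set v : V := ∑ l, (inner ℝ g (b l : E)) • b l with hv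
  have h1 : inner ℝ g (v : E) =
      (fun l => inner ℝ g (b l : E)) ⬝ᵥ (fun l => inner ℝ g (b l : E)) := by
    simp [hv, inner_sum, inner_smul_right, dotProduct]
  have h2 : ‖(v : E)‖ ^ 2 =
      (fun l => inner ℝ g (b l : E)) ⬝ᵥ (fun l => inner ℝ g (b l : E)) := by
    have h := b.sum_sq_norm_inner_right v
    simp only [Real.norm_eq_abs, sq_abs, Submodule.coe_norm] at h
    rw [← h, dotProduct]
    refine Finset.sum_congr rfl fun l _ => ?_
    rw [hv, b.orthonormal.inner_right_fintype]
    ring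
  have h3 := hg v v.2
  rw [h1, ← h2] at h3
  rw [← h2]
  nlinarith [norm_nonneg (v : E), sq_nonneg (G - ‖(v : E)‖)]

/-- The linearized regret of Online Newton Step, with its quadratic gain. Only the dimension of
the decision set enters. -/
theorem ons_linearized_regret [FiniteDimensional ℝ E] {S : Set E} (hS : IsCompact S)
    (hconv : Convex ℝ S) {γ ε G : ℝ} (hγ : 0 < γ) (hε : 0 < ε)
    (grad : ℕ → E → E) {x₁ : E} (hx₁ : x₁ ∈ S) (j m : ℕ) {u : E} (hu : u ∈ S)
    (hg : ∀ k < m, ∀ v ∈ vectorSpan ℝ S, inner ℝ (onsGrad S γ ε grad x₁ j k) v ≤ G * ‖v‖) :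
    ∑ k ∈ Finset.range m,
      (inner ℝ (onsGrad S γ ε grad x₁ j k) ((onsState S γ ε grad x₁ j k).1 - u) -
        γ / 2 * inner ℝ (onsGrad S γ ε grad x₁ j k) ((onsState S γ ε grad x₁ j k).1 - u) ^ 2) ≤
      γ / 2 * (ε * ‖x₁ - u‖ ^ 2) + 1 / (2 * γ) *
        (Module.finrank ℝ (vectorSpan ℝ S) * (Real.log (ε + m * G ^ 2) - Real.log ε)) := by
  set b := stdOrthonormalBasis ℝ (vectorSpan ℝ S)
  set g := onsGrad S γ ε grad x₁ j with hgdef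
  set x : ℕ → E := fun k => (onsState S γ ε grad x₁ j k).1 with hx
  set a : ℕ → Fin (Module.finrank ℝ (vectorSpan ℝ S)) → ℝ :=
    fun i l => inner ℝ (g i) (b l : E) with ha
  set Q : ℕ → E → ℝ := fun k v => ε * ‖v‖ ^ 2 + ∑ i ∈ Finset.range k, inner ℝ (g i) v ^ 2 with hQ
  have hxS : ∀ k, x k ∈ S := onsState_fst_mem hS γ ε grad hx₁ j
  have hQA : ∀ k v, inner ℝ ((onsState S γ ε grad x₁ j k).2 v) v = Q k v := fun k v => by
    simp only [inner_onsState_snd, real_inner_self_eq_norm_sq, hQ, sq, hgdef]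
  have hstep : ∀ k, γ⁻¹ * inner ℝ (g k) (x k - u) ≤
      1 / 2 * (Q (k + 1) (x k - u) - Q (k + 1) (x (k + 1) - u)) + 1 / 2 * (γ⁻¹ ^ 2 *
        (Real.log (regGram ε a (k + 1)).det - Real.log (regGram ε a k).det)) := by
    intro k
    have hopt := onsState_optimality hS hconv γ hε grad hx₁ j k hu
    have hdet : 2 * γ⁻¹ * inner ℝ (g k) (x k - x (k + 1)) - Q (k + 1) (x k - x (k + 1)) ≤
        γ⁻¹ ^ 2 * (Real.log (regGram ε a (k + 1)).det - Real.log (regGram ε a k).det) := by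
      obtain ⟨c, hc, hcn⟩ := exists_coord_of_mem b
        (vsub_mem_vectorSpan ℝ (hxS k) (hxS (k + 1)))
      have := linear_sub_quadratic_le_log_det hε a k γ⁻¹ c
      simp only [vsub_eq_sub] at hc hcn
      simp only [hQ, hc, hcn]
      exact this
    have hpol : Q (k + 1) (x k - u) = Q (k + 1) (x (k + 1) - x k) + Q (k + 1) (x (k + 1) - u) +
        2 * inner ℝ ((onsState S γ ε grad x₁ j (k + 1)).2 (x (k + 1) - x k)) (u - x (k + 1)) := by
      have h1 : x k - u = -((x (k + 1) - x k) + (u - x (k + 1))) := by abel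
      have h2 : x (k + 1) - u = -(u - x (k + 1)) := by abel
      rw [← hQA, ← hQA, ← hQA, h1, h2]
      simp only [map_neg, map_add, inner_neg_neg, inner_add_left, inner_add_right]
      rw [inner_onsState_snd_comm _ _ _ _ _ _ _ (u - x (k + 1)) (x (k + 1) - x k)]
      ring
    have hQneg : Q (k + 1) (x k - x (k + 1)) = Q (k + 1) (x (k + 1) - x k) := by
      simp only [hQ, ← neg_sub (x (k + 1)) (x k), inner_neg_right, neg_sq,
        norm_neg]
    have hsplit : inner ℝ (g k) (x k - u) =
        inner ℝ (g k) (x k - x (k + 1)) - inner ℝ (g k) (u - x (k + 1)) := by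
      rw [← inner_sub_right]; congr 1; abel
    have hopt' : 0 ≤ inner ℝ ((onsState S γ ε grad x₁ j (k + 1)).2 (x (k + 1) - x k))
        (u - x (k + 1)) + γ⁻¹ * inner ℝ (g k) (u - x (k + 1)) := hopt
    rw [hsplit, mul_sub]
    linarith
  have hsum : ∀ m, ∑ k ∈ Finset.range m,
      (γ⁻¹ * inner ℝ (g k) (x k - u) - 1 / 2 * inner ℝ (g k) (x k - u) ^ 2) ≤
      1 / 2 * (Q 0 (x 0 - u) - Q m (x m - u)) + 1 / 2 * (γ⁻¹ ^ 2 *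
        (Real.log (regGram ε a m).det - Real.log (regGram ε a 0).det)) := by
    intro m
    induction m with
    | zero => simp
    | succ m ih =>
      rw [Finset.sum_range_succ]
      have h1 := hstep m
      have h2 : Q (m + 1) (x m - u) = Q m (x m - u) + inner ℝ (g m) (x m - u) ^ 2 := by
        simp only [hQ, Finset.sum_range_succ, add_assoc]
      linarith
  have hlog := log_det_regGram_le (G := G) hε a m fun i hi => dotProduct_coord_le b (hg i hi)
  have hQm : 0 ≤ Q m (x m - u) :=
    add_nonneg (by positivity) (Finset.sum_nonneg fun i _ => sq_nonneg _)
  have hQ0 : Q 0 (x 0 - u) = ε * ‖x₁ - u‖ ^ 2 := by simp [hQ, hx, onsState]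
  have h0 := log_det_regGram_zero (ε := ε) a
  have hfin : ∑ k ∈ Finset.range m,
      (γ⁻¹ * inner ℝ (g k) (x k - u) - 1 / 2 * inner ℝ (g k) (x k - u) ^ 2) ≤
      1 / 2 * (ε * ‖x₁ - u‖ ^ 2) + 1 / 2 * (γ⁻¹ ^ 2 *
        (Module.finrank ℝ (vectorSpan ℝ S) * (Real.log (ε + m * G ^ 2) - Real.log ε))) := by
    refine (hsum m).trans (add_le_add (by linarith) ?_)
    refine mul_le_mul_of_nonneg_left (mul_le_mul_of_nonneg_left ?_ (by positivity)) (by norm_num)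
    linarith
  calc _ = γ * ∑ k ∈ Finset.range m,
        (γ⁻¹ * inner ℝ (g k) (x k - u) - 1 / 2 * inner ℝ (g k) (x k - u) ^ 2) := by
        rw [Finset.mul_sum]
        refine Finset.sum_congr rfl fun k _ => ?_
        rw [mul_sub, mul_inv_cancel_left₀ hγ.ne']
        ring
    _ ≤ γ * _ := mul_le_mul_of_nonneg_left hfin hγ.le
    _ = _ := by field_simp

end OnlineNewtonStep

/-! ### Weights of Follow-the-Leading-History -/

section FollowTheLeadingHistory

variable {E : Type*}

lemma flhWeight_self {ζ : ℝ} {f : ℕ → E → ℝ} {x : ℕ → ℕ → E} {r : ℕ} (hr : 1 ≤ r) :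
    flhWeight ζ f x r r = 1 / r := by
  match r, hr with
  | 1, _ => simp [flhWeight]
  | t + 2, _ => simp [flhWeight]

lemma flhWeight_succ {ζ : ℝ} {f : ℕ → E → ℝ} {x : ℕ → ℕ → E} {t i : ℕ} (hi : i ∈ Finset.Icc 1 t) :
    flhWeight ζ f x (t + 1) i = (1 - 1 / ((t : ℝ) + 1)) *
      (flhWeight ζ f x t i * Real.exp (-ζ * f t (x i t)) /
        ∑ j ∈ Finset.Icc 1 t, flhWeight ζ f x t j * Real.exp (-ζ * f t (x j t))) := by
  obtain ⟨h1, h2⟩ := Finset.mem_Icc.1 hi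
  obtain ⟨t, rfl⟩ : ∃ s, t = s + 1 := ⟨t - 1, by omega⟩
  have h3 : i ≠ t + 2 := by omega
  rw [flhWeight, if_neg h3, if_pos hi]
  push_cast
  norm_num [add_assoc]

lemma flhWeight_pos {ζ : ℝ} {f : ℕ → E → ℝ} {x : ℕ → ℕ → E} {t i : ℕ}
    (hi : i ∈ Finset.Icc 1 t) : 0 < flhWeight ζ f x t i := by
  induction t generalizing i with
  | zero => simp at hi
  | succ t ih =>
    obtain ⟨h1, h2⟩ := Finset.mem_Icc.1 hi
    rcases h2.eq_or_lt with rfl | h2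
    · rw [flhWeight_self h1]
      positivity
    · have hi' : i ∈ Finset.Icc 1 t := Finset.mem_Icc.2 ⟨h1, by omega⟩
      rw [flhWeight_succ hi']
      have ht : (0 : ℝ) < t := by exact_mod_cast (by omega : 0 < t)
      refine mul_pos ?_ (div_pos (mul_pos (ih hi') (Real.exp_pos _))
        (Finset.sum_pos (fun j hj => mul_pos (ih hj) (Real.exp_pos _)) ⟨i, hi'⟩))
      rw [sub_pos, div_lt_one (by positivity)]
      linarith

lemma sum_flhWeight_mul_exp_pos {ζ : ℝ} {f : ℕ → E → ℝ} {x : ℕ → ℕ → E} {t : ℕ} (ht : 1 ≤ t) :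
    0 < ∑ j ∈ Finset.Icc 1 t, flhWeight ζ f x t j * Real.exp (-ζ * f t (x j t)) :=
  Finset.sum_pos (fun _ hj => mul_pos (flhWeight_pos hj) (Real.exp_pos _))
    ⟨1, Finset.mem_Icc.2 ⟨le_rfl, ht⟩⟩

lemma sum_flhWeight {ζ : ℝ} {f : ℕ → E → ℝ} {x : ℕ → ℕ → E} {t : ℕ} (ht : 1 ≤ t) :
    ∑ i ∈ Finset.Icc 1 t, flhWeight ζ f x t i = 1 := by
  obtain ⟨t, rfl⟩ : ∃ s, t = s + 1 := ⟨t - 1, by omega⟩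
  rw [Finset.sum_Icc_succ_top (by omega), flhWeight_self (by omega)]
  rcases t.eq_zero_or_pos with rfl | h
  · simp
  · rw [Finset.sum_congr rfl fun i hi => flhWeight_succ hi, ← Finset.mul_sum, ← Finset.sum_div,
      div_self (sum_flhWeight_mul_exp_pos h).ne']
    push_cast
    ring

/-- The logarithm of the weight of learner `r`, multiplied by the number of the round, is a
potential for the regret against that learner since its start. -/
theorem flh_regret_le_log [AddCommGroup E] [Module ℝ E] {ζ : ℝ} {f : ℕ → E → ℝ}
    {x : ℕ → ℕ → E} {p : ℕ → E} {r m : ℕ} (hr : 1 ≤ r)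
    (hmix : ∀ t ∈ Finset.Ico r (r + m),
      ∑ i ∈ Finset.Icc 1 t, flhWeight ζ f x t i * Real.exp (-ζ * f t (x i t)) ≤
        Real.exp (-ζ * f t (p t))) :
    ζ * ∑ t ∈ Finset.Ico r (r + m), (f t (p t) - f t (x r t)) ≤
      Real.log (((r + m : ℕ) : ℝ) * flhWeight ζ f x (r + m) r) := by
  induction m with
  | zero =>
    have : (r : ℝ) ≠ 0 := by exact_mod_cast (by omega : r ≠ 0)
    simp [flhWeight_self hr, this]
  | succ m ih =>
    have ih := ih fun t ht => hmix t (by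
      obtain ⟨h1, h2⟩ := Finset.mem_Ico.1 ht
      exact Finset.mem_Ico.2 ⟨h1, by omega⟩)
    have hm := hmix (r + m) (Finset.mem_Ico.2 ⟨by omega, by omega⟩)
    rw [← add_assoc, Finset.sum_Ico_succ_top (by omega), mul_add]
    set t := r + m with ht
    have hmem : r ∈ Finset.Icc 1 t := Finset.mem_Icc.2 ⟨hr, by omega⟩
    have hZ := sum_flhWeight_mul_exp_pos (ζ := ζ) (f := f) (x := x) (t := t) (by omega)
    have hw := flhWeight_pos (ζ := ζ) (f := f) (x := x) hmem
    have ht0 : (0 : ℝ) < t := by exact_mod_cast (by omega : 0 < t)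
    rw [flhWeight_succ hmem]
    set Z := ∑ i ∈ Finset.Icc 1 t, flhWeight ζ f x t i * Real.exp (-ζ * f t (x i t))
    have heq : ((t + 1 : ℕ) : ℝ) * ((1 - 1 / ((t : ℝ) + 1)) *
        (flhWeight ζ f x t r * Real.exp (-ζ * f t (x r t)) / Z)) =
        t * flhWeight ζ f x t r * (Real.exp (-ζ * f t (x r t)) / Z) := by
      push_cast
      field_simp
      ring
    rw [heq, Real.log_mul (by positivity) (by positivity),
      Real.log_div (Real.exp_pos _).ne' hZ.ne', Real.log_exp]
    have hlogZ : Real.log Z ≤ -ζ * f t (p t) := by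
      simpa using Real.log_le_log hZ hm
    linarith

end FollowTheLeadingHistory

/-! ### Logarithmic regret on intervals -/

section AdaptiveRegret

lemma onsRate_pos {α G D : ℝ} (hα : 0 < α) (hG : 0 < G) (hD : 0 < D) : 0 < onsRate α G D := by
  unfold onsRate
  positivity

lemma onsRate_le {α G D : ℝ} (hα : 0 < α) : onsRate α G D ≤ α := by
  have := min_le_right (1 / (4 * G * D)) α
  unfold onsRate
  linarith

lemma onsRate_mul_le_one {α G D : ℝ} (hG : 0 < G) (hD : 0 < D) : onsRate α G D * D * G ≤ 1 := by
  have h := min_le_left (1 / (4 * G * D)) α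
  rw [le_div_iff₀ (by positivity)] at h
  unfold onsRate
  linarith

lemma onsReg_pos {α G D : ℝ} (hα : 0 < α) (hG : 0 < G) (hD : 0 < D) : 0 < onsReg α G D := by
  have := onsRate_pos hα hG hD
  unfold onsReg
  positivity

lemma log_one_add_natCast_le {T : ℕ} (hT : 1 ≤ T) :
    Real.log (1 + T) ≤ 1 + Real.log T := by
  have h1 : (1 : ℝ) ≤ T := by exact_mod_cast hT
  calc Real.log (1 + T) ≤ Real.log (2 * T) := Real.log_le_log (by positivity) (by linarith)
    _ = Real.log 2 + Real.log T := Real.log_mul (by norm_num) (by positivity)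
    _ ≤ _ := by linarith [Real.log_two_lt_d9]

variable {E : Type*} [NormedAddCommGroup E] [InnerProductSpace ℝ E]

lemma onsPrediction_mem {S : Set E} (hS : IsCompact S) (γ ε : ℝ) (grad : ℕ → E → E) {x₁ : E}
    (hx₁ : x₁ ∈ S) (j t : ℕ) : onsPrediction S γ ε grad x₁ j t ∈ S :=
  onsState_fst_mem hS γ ε grad hx₁ j (t - j)

lemma flhOns_mem {α G D : ℝ} {S : Set E} (hconv : Convex ℝ S) (hS : IsCompact S) {T : ℕ}
    {f : ℕ → E → ℝ} {grad : ℕ → E → E} {x₁ : ℕ → E} (hx₁ : ∀ j ∈ Finset.Icc 1 T, x₁ j ∈ S)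
    {t : ℕ} (ht : t ∈ Finset.Icc 1 T) : flhOns α G D S f grad x₁ t ∈ S := by
  obtain ⟨h1, h2⟩ := Finset.mem_Icc.1 ht
  refine hconv.sum_mem (fun i hi => (flhWeight_pos hi).le) (sum_flhWeight h1) fun i hi => ?_
  exact onsPrediction_mem hS _ _ grad
    (hx₁ i (Finset.mem_Icc.2 ⟨(Finset.mem_Icc.1 hi).1, (Finset.mem_Icc.1 hi).2.trans h2⟩)) i t

variable [FiniteDimensional ℝ E]

/-- The regret of Online Newton Step started in round `r` is logarithmic from its start on. -/
theorem ons_regret {α G D : ℝ} (hα : 0 < α) (hG : 0 < G) (hD : 0 < D) {S : Set E}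
    (hconv : Convex ℝ S) (hS : IsCompact S) (hdiam : ∀ x ∈ S, ∀ y ∈ S, ‖x - y‖ ≤ D)
    {T : ℕ} (hT : 1 ≤ T) {f : ℕ → E → ℝ} {grad : ℕ → E → E}
    (hgrad : ∀ t ∈ Finset.Icc 1 T, ∀ x ∈ S, HasGradientWithinAt (f t) (grad t x) S x)
    (hexp : ∀ t ∈ Finset.Icc 1 T, ExpConcaveOn α S (f t) (grad t))
    (hlip : ∀ t ∈ Finset.Icc 1 T, LossLipschitzOn G S (f t))
    {r m : ℕ} (hr : 1 ≤ r) (hm : r + m ≤ T + 1) {x₁ u : E} (hx₁ : x₁ ∈ S) (hu : u ∈ S) :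
    ∑ t ∈ Finset.Ico r (r + m),
      (f t (onsPrediction S (onsRate α G D) (onsReg α G D) grad x₁ r t) - f t u) ≤
      1 / (2 * onsRate α G D) *
        (1 + Module.finrank ℝ (vectorSpan ℝ S) * (1 + Real.log T)) := by
  have hγ := onsRate_pos hα hG hD
  have hε := onsReg_pos hα hG hD
  have hγα := onsRate_le (G := G) (D := D) hα
  have hγ1 := onsRate_mul_le_one (α := α) hG hD
  have hεdef : onsReg α G D = 1 / (onsRate α G D ^ 2 * D ^ 2) := rfl
  set γ := onsRate α G D
  set ε := onsReg α G D
  have hxS := onsState_fst_mem hS γ ε grad hx₁ r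
  have hmem : ∀ k < m, r + k ∈ Finset.Icc 1 T := fun k hk => Finset.mem_Icc.2 ⟨by omega, by omega⟩
  have hlin := ons_linearized_regret (G := G) hS hconv hγ hε grad hx₁ r m hu
    fun k hk v hv => (hlip _ (hmem k hk)).inner_grad_le_of_mem_vectorSpan hconv
      (hgrad _ (hmem k hk)) (hxS k) hv
  have hloss : ∑ t ∈ Finset.Ico r (r + m), (f t (onsPrediction S γ ε grad x₁ r t) - f t u) ≤
      ∑ k ∈ Finset.range m,
      (inner ℝ (onsGrad S γ ε grad x₁ r k) ((onsState S γ ε grad x₁ r k).1 - u) -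
        γ / 2 * inner ℝ (onsGrad S γ ε grad x₁ r k) ((onsState S γ ε grad x₁ r k).1 - u) ^ 2) := by
    rw [Finset.sum_Ico_eq_sum_range, Nat.add_sub_cancel_left]
    refine Finset.sum_le_sum fun k hk => ?_
    have hk' := hexp _ (hmem k (Finset.mem_range.1 hk)) _ (hxS k) u hu
    rw [← neg_sub, inner_neg_right, neg_sq] at hk'
    simp only [onsPrediction, Nat.add_sub_cancel_left, onsGrad]
    nlinarith [sq_nonneg (inner ℝ (grad (r + k) (onsState S γ ε grad x₁ r k).1)
      ((onsState S γ ε grad x₁ r k).1 - u))]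
  have h1 : γ / 2 * (ε * ‖x₁ - u‖ ^ 2) ≤ 1 / (2 * γ) := by
    have hd2 : ‖x₁ - u‖ ^ 2 ≤ D ^ 2 :=
      pow_le_pow_left₀ (norm_nonneg _) (hdiam _ hx₁ _ hu) 2
    calc γ / 2 * (ε * ‖x₁ - u‖ ^ 2) ≤ γ / 2 * (ε * D ^ 2) := by gcongr
      _ = 1 / (2 * γ) := by rw [hεdef]; field_simp
  have h2 : Real.log (ε + m * G ^ 2) - Real.log ε ≤ 1 + Real.log T := by
    rw [← Real.log_div (by positivity) hε.ne']
    refine le_trans (Real.log_le_log (by positivity) ?_) (log_one_add_natCast_le hT)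
    have hmT : (m : ℝ) ≤ T := by exact_mod_cast (by omega : m ≤ T)
    have h3 : (γ * D * G) ^ 2 ≤ 1 := pow_le_one₀ (by positivity) hγ1
    have h4 : (ε + m * G ^ 2) / ε = 1 + m * (γ * D * G) ^ 2 := by
      rw [add_div, div_self hε.ne', hεdef]
      field_simp
    rw [h4]
    nlinarith [(m.cast_nonneg : (0 : ℝ) ≤ m)]
  calc _ ≤ _ := hloss.trans hlin
    _ ≤ 1 / (2 * γ) + 1 / (2 * γ) *
        (Module.finrank ℝ (vectorSpan ℝ S) * (1 + Real.log T)) := by gcongr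
    _ = _ := by ring

/-- **Strong adaptivity**: on every interval the regret against every fixed point is `O(d log T)`,
because the learner started at the left end of the interval has this regret and
Follow-the-Leading-History loses only `log T / α` against it. -/
theorem flhOns_interval_regret {α G D : ℝ} (hα : 0 < α) (hG : 0 < G) (hD : 0 < D) {S : Set E}
    (hconv : Convex ℝ S) (hS : IsCompact S) (hdiam : ∀ x ∈ S, ∀ y ∈ S, ‖x - y‖ ≤ D)
    (hdim : 1 ≤ Module.finrank ℝ (vectorSpan ℝ S))
    {T : ℕ} (hT : 1 ≤ T) {f : ℕ → E → ℝ} {grad : ℕ → E → E}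
    (hgrad : ∀ t ∈ Finset.Icc 1 T, ∀ x ∈ S, HasGradientWithinAt (f t) (grad t x) S x)
    (hexp : ∀ t ∈ Finset.Icc 1 T, ExpConcaveOn α S (f t) (grad t))
    (hlip : ∀ t ∈ Finset.Icc 1 T, LossLipschitzOn G S (f t))
    {x₁ : ℕ → E} (hx₁ : ∀ j ∈ Finset.Icc 1 T, x₁ j ∈ S)
    {r m : ℕ} (hr : 1 ≤ r) (hrT : r ≤ T) (hm : r + m ≤ T + 1) {u : E} (hu : u ∈ S) :
    ∑ t ∈ Finset.Ico r (r + m), (f t (flhOns α G D S f grad x₁ t) - f t u) ≤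
      (1 / α + 1 / onsRate α G D) * (1 + Real.log T) *
        Module.finrank ℝ (vectorSpan ℝ S) := by
  have hons := ons_regret hα hG hD hconv hS hdiam hT hgrad hexp hlip hr hm
    (hx₁ r (Finset.mem_Icc.2 ⟨hr, hrT⟩)) hu
  have hflh := flh_regret_le_log (ζ := α) (f := f)
    (x := fun j t => onsPrediction S (onsRate α G D) (onsReg α G D) grad (x₁ j) j t)
    (p := flhOns α G D S f grad x₁) (r := r) (m := m) hr (fun t ht => by
      obtain ⟨h1, h2⟩ := Finset.mem_Ico.1 ht
      have htT : t ∈ Finset.Icc 1 T := Finset.mem_Icc.2 ⟨by omega, by omega⟩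
      refine (hexp t htT).sum_exp_le hα hconv (hgrad t htT)
        (fun i hi => (flhWeight_pos hi).le) (sum_flhWeight (by omega)) fun i hi => ?_
      obtain ⟨h3, h4⟩ := Finset.mem_Icc.1 hi
      exact onsPrediction_mem hS _ _ grad (hx₁ i (Finset.mem_Icc.2 ⟨h3, by omega⟩)) i t)
  have hlog : Real.log (((r + m : ℕ) : ℝ) * flhWeight α f
      (fun j t => onsPrediction S (onsRate α G D) (onsReg α G D) grad (x₁ j) j t) (r + m) r) ≤
      1 + Real.log T := by
    have hmem : r ∈ Finset.Icc 1 (r + m) := Finset.mem_Icc.2 ⟨hr, by omega⟩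
    have hpos : (0 : ℝ) < ((r + m : ℕ) : ℝ) := by exact_mod_cast (by omega : 0 < r + m)
    refine le_trans (Real.log_le_log (mul_pos hpos (flhWeight_pos hmem)) ?_)
      (log_one_add_natCast_le hT)
    have hle : ((r + m : ℕ) : ℝ) ≤ 1 + T := by exact_mod_cast (by omega : r + m ≤ 1 + T)
    refine le_trans (mul_le_of_le_one_right hpos.le ?_) hle
    rw [← sum_flhWeight (ζ := α) (f := f) (x := fun j t =>
      onsPrediction S (onsRate α G D) (onsReg α G D) grad (x₁ j) j t) (t := r + m) (by omega)]
    exact Finset.single_le_sum (fun i hi => (flhWeight_pos hi).le) hmem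
  have hγ := onsRate_pos hα hG hD
  set γ := onsRate α G D
  set d : ℝ := (Module.finrank ℝ (vectorSpan ℝ S) : ℝ)
  have hd : 1 ≤ d := Nat.one_le_cast.2 hdim
  have hl : 0 ≤ Real.log T := Real.log_natCast_nonneg T
  have h1 : ∑ t ∈ Finset.Ico r (r + m), (f t (flhOns α G D S f grad x₁ t) -
      f t (onsPrediction S γ (onsReg α G D) grad (x₁ r) r t)) ≤ 1 / α * (1 + Real.log T) := by
    rw [one_div, ← div_eq_inv_mul, le_div_iff₀ hα, mul_comm]
    exact hflh.trans hlog
  calc _ = ∑ t ∈ Finset.Ico r (r + m), (f t (flhOns α G D S f grad x₁ t) -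
        f t (onsPrediction S γ (onsReg α G D) grad (x₁ r) r t)) +
        ∑ t ∈ Finset.Ico r (r + m),
          (f t (onsPrediction S γ (onsReg α G D) grad (x₁ r) r t) - f t u) := by
        rw [← Finset.sum_add_distrib]
        exact Finset.sum_congr rfl fun t _ => by ring
    _ ≤ 1 / α * (1 + Real.log T) + 1 / (2 * γ) * (1 + d * (1 + Real.log T)) := add_le_add h1 hons
    _ ≤ 1 / α * ((1 + Real.log T) * d) + 1 / (2 * γ) * (2 * ((1 + Real.log T) * d)) := by
        have h2 : 1 + Real.log T ≤ (1 + Real.log T) * d :=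
          le_mul_of_one_le_right (by linarith) hd
        gcongr
        linarith
    _ = _ := by field_simp

end AdaptiveRegret

/-! ### Dynamic regret from interval regret -/

section DynamicRegret

variable {E : Type*} [NormedAddCommGroup E]

lemma norm_sub_le_sum_norm_sub (z : ℕ → E) {r t : ℕ} (hrt : r ≤ t) :
    ‖z t - z r‖ ≤ ∑ i ∈ Finset.Icc (r + 1) t, ‖z i - z (i - 1)‖ := by
  induction t, hrt using Nat.le_induction with
  | base => simp
  | succ t ht ih =>
    rw [Finset.sum_Icc_succ_top (by omega), Nat.add_sub_cancel]
    have := norm_sub_le_norm_sub_add_norm_sub (z (t + 1)) (z t) (z r)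
    linarith

/-- On a block of length at most `L`, replace the moving comparator by its first point. -/
lemma block_regret_le {S : Set E} {G K : ℝ} (hG : 0 ≤ G) {f : ℕ → E → ℝ} {x z : ℕ → E}
    {r m L : ℕ} (hm : 1 ≤ m) (hmL : m ≤ L)
    (hlip : ∀ t ∈ Finset.Ico r (r + m), LossLipschitzOn G S (f t))
    (hz : ∀ t ∈ Finset.Ico r (r + m), z t ∈ S)
    (hreg : ∀ u ∈ S, ∑ t ∈ Finset.Ico r (r + m), (f t (x t) - f t u) ≤ K) :
    ∑ t ∈ Finset.Ico r (r + m), (f t (x t) - f t (z t)) ≤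
      K + G * L * ∑ t ∈ Finset.Ico (r + 1) (r + m), ‖z t - z (t - 1)‖ := by
  have hr : r ∈ Finset.Ico r (r + m) := Finset.mem_Ico.2 ⟨le_rfl, by omega⟩
  set V := ∑ t ∈ Finset.Ico (r + 1) (r + m), ‖z t - z (t - 1)‖ with hV
  have hV0 : 0 ≤ V := Finset.sum_nonneg fun _ _ => norm_nonneg _
  have hdrift : ∑ t ∈ Finset.Ico r (r + m), (f t (z r) - f t (z t)) ≤ G * L * V := by
    calc _ ≤ ∑ t ∈ Finset.Ico r (r + m), G * V := Finset.sum_le_sum fun t ht => by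
          obtain ⟨h1, h2⟩ := Finset.mem_Ico.1 ht
          refine (le_abs_self _).trans ((hlip t ht _ (hz r hr) _ (hz t ht)).trans ?_)
          refine mul_le_mul_of_nonneg_left ?_ hG
          rw [norm_sub_rev]
          refine (norm_sub_le_sum_norm_sub z h1).trans
            (Finset.sum_le_sum_of_subset_of_nonneg (fun i hi => ?_) fun _ _ _ => norm_nonneg _)
          obtain ⟨h3, h4⟩ := Finset.mem_Icc.1 hi
          exact Finset.mem_Ico.2 ⟨h3, by omega⟩
      _ = m * (G * V) := by simp
      _ ≤ L * (G * V) := by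
          have : (m : ℝ) ≤ L := by exact_mod_cast hmL
          gcongr
      _ = _ := by ring
  calc _ = ∑ t ∈ Finset.Ico r (r + m), (f t (x t) - f t (z r)) +
        ∑ t ∈ Finset.Ico r (r + m), (f t (z r) - f t (z t)) := by
        rw [← Finset.sum_add_distrib]
        exact Finset.sum_congr rfl fun t _ => by ring
    _ ≤ _ := add_le_add (hreg _ (hz r hr)) hdrift

/-- Cutting the horizon into blocks of length `L` turns regret `K` on every interval into dynamic
regret. -/
theorem dynamicRegret_le_of_interval_regret {S : Set E} {G K : ℝ} (hG : 0 ≤ G) (hK : 0 ≤ K)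
    {T : ℕ} {f : ℕ → E → ℝ} {x z : ℕ → E}
    (hlip : ∀ t ∈ Finset.Icc 1 T, LossLipschitzOn G S (f t))
    (hz : ∀ t ∈ Finset.Icc 1 T, z t ∈ S)
    (hreg : ∀ r m, 1 ≤ r → r ≤ T → r + m ≤ T + 1 → ∀ u ∈ S,
      ∑ t ∈ Finset.Ico r (r + m), (f t (x t) - f t u) ≤ K)
    {L : ℕ} (hL : 1 ≤ L) {s : ℕ} (hs : s ≤ T) :
    dynamicRegret f x z s ≤ (s / L + 1) * K + G * L * pathVariation z s := by
  have hL0 : (0 : ℝ) < L := by exact_mod_cast hL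
  have hblock : ∀ r m, 1 ≤ r → 1 ≤ m → m ≤ L → r + m ≤ T + 1 →
      ∑ t ∈ Finset.Ico r (r + m), (f t (x t) - f t (z t)) ≤
        K + G * L * ∑ t ∈ Finset.Ico (r + 1) (r + m), ‖z t - z (t - 1)‖ := by
    intro r m hr hm hmL hrm
    have hsub : ∀ t ∈ Finset.Ico r (r + m), t ∈ Finset.Icc 1 T := fun t ht => by
      obtain ⟨h1, h2⟩ := Finset.mem_Ico.1 ht
      exact Finset.mem_Icc.2 ⟨by omega, by omega⟩
    exact block_regret_le hG hm hmL (fun t ht => hlip t (hsub t ht))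
      (fun t ht => hz t (hsub t ht)) (hreg r m hr (by omega) hrm)
  simp only [dynamicRegret, pathVariation, ← Finset.Ico_add_one_right_eq_Icc]
  induction s using Nat.strong_induction_on with
  | _ s ih =>
  rcases s.eq_zero_or_pos with rfl | hs0
  · simpa using hK
  rcases le_or_gt s L with hsL | hsL
  · have h1 := hblock 1 s le_rfl hs0 hsL (by omega)
    rw [add_comm 1 s] at h1
    have h2 : 0 ≤ (s : ℝ) / L * K := by positivity
    norm_num at h1 ⊢
    linarith
  · have h1 := ih (s - L) (by omega) (by omega)
    have h2 := hblock (s - L + 1) L (by omega) hL le_rfl (by omega)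
    rw [show s - L + 1 + L = s + 1 by omega] at h2
    have h3 : ((s - L : ℕ) : ℝ) / L + 1 = s / L := by
      rw [Nat.cast_sub hsL.le]
      field_simp
      ring
    rw [h3] at h1
    rw [← Finset.sum_Ico_consecutive _ (by omega : 1 ≤ s - L + 1) (by omega : s - L + 1 ≤ s + 1)]
    have h4 : ∑ t ∈ Finset.Ico 2 (s - L + 1), ‖z t - z (t - 1)‖ +
        ∑ t ∈ Finset.Ico (s - L + 1 + 1) (s + 1), ‖z t - z (t - 1)‖ ≤
        ∑ t ∈ Finset.Ico 2 (s + 1), ‖z t - z (t - 1)‖ := by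
      rw [← Finset.sum_Ico_consecutive _ (by omega : 2 ≤ s - L + 1 + 1)
        (by omega : s - L + 1 + 1 ≤ s + 1)]
      refine add_le_add_left (Finset.sum_le_sum_of_subset_of_nonneg
        (Finset.Ico_subset_Ico_right (by omega)) fun _ _ _ => norm_nonneg _) _
    have h5 := mul_le_mul_of_nonneg_left h4 (by positivity : 0 ≤ G * L)
    rw [mul_add] at h5
    linarith

lemma pathVariation_nonneg (z : ℕ → E) (T : ℕ) : 0 ≤ pathVariation z T :=
  Finset.sum_nonneg fun _ _ => norm_nonneg _

lemma pathVariation_le {S : Set E} {D : ℝ} (hD : 0 ≤ D) (hdiam : ∀ x ∈ S, ∀ y ∈ S, ‖x - y‖ ≤ D)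
    {z : ℕ → E} {T : ℕ} (hz : ∀ t ∈ Finset.Icc 1 T, z t ∈ S) : pathVariation z T ≤ T * D := by
  calc pathVariation z T ≤ ∑ t ∈ Finset.Icc 2 T, D := Finset.sum_le_sum fun t ht => by
        obtain ⟨h1, h2⟩ := Finset.mem_Icc.1 ht
        exact hdiam _ (hz t (Finset.mem_Icc.2 ⟨by omega, h2⟩)) _
          (hz (t - 1) (Finset.mem_Icc.2 ⟨by omega, by omega⟩))
    _ = ((T + 1 - 2 : ℕ) : ℝ) * D := by simp
    _ ≤ T * D := by
        have : ((T + 1 - 2 : ℕ) : ℝ) ≤ T := by exact_mod_cast (by omega : T + 1 - 2 ≤ T)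
        gcongr

/-- The choice of the block length: `L = T` if `T V ≤ d`, and `L = ⌈√(d T / V)⌉` otherwise. -/
lemma le_max_of_forall_block_length {R c G D T V d : ℝ} {N : ℕ} (hN : 1 ≤ N) (hNT : T = N)
    (hc : 0 ≤ c) (hG : 0 ≤ G) (hD : 0 ≤ D) (hV : 0 ≤ V) (hVT : V ≤ T * D) (hd : 1 ≤ d)
    (hR : ∀ L : ℕ, 1 ≤ L → R ≤ (T / L + 1) * (c * d) + G * L * V) :
    R ≤ (2 * c + G * (1 + √D)) * max √(d * T * V) d := by
  have hT : 1 ≤ T := by rw [hNT]; exact_mod_cast hN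
  have hd0 : 0 ≤ d := by linarith
  rcases le_or_gt (T * V) d with hTV | hTV
  · have h1 := hR N hN
    rw [← hNT, div_self (by linarith)] at h1
    have h2 : G * T * V ≤ G * d := by
      rw [mul_assoc]
      exact mul_le_mul_of_nonneg_left hTV hG
    calc R ≤ (2 * c + G * (1 + 0)) * d := by linarith
      _ ≤ _ := by
        gcongr
        · exact Real.sqrt_nonneg D
        · exact le_max_right _ _
  · have hV0 : 0 < V := pos_of_mul_pos_right (by linarith) (by linarith : 0 ≤ T)
    have hdp : 0 < d := by linarith
    have hTp : 0 < T := by linarith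
    set q := √(d * T * V) with hq
    have hqq : q * q = d * T * V := Real.mul_self_sqrt (by positivity)
    have hqp : 0 < q := Real.sqrt_pos.2 (by positivity)
    -- The real block length `√(d T / V) = √(d T V) / V`, rounded up.
    have hLp : 0 < ⌈q / V⌉₊ := Nat.ceil_pos.2 (by positivity)
    have hL1 : q / V ≤ ⌈q / V⌉₊ := Nat.le_ceil _
    have hL2 : (⌈q / V⌉₊ : ℝ) < q / V + 1 := Nat.ceil_lt_add_one (by positivity)
    have h1 := hR _ hLp
    set L : ℝ := (⌈q / V⌉₊ : ℝ)
    have hLp' : 0 < L := lt_of_lt_of_le (by positivity) hL1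
    have hTL : T / L * d ≤ q := by
      rw [div_mul_eq_mul_div, div_le_iff₀ hLp']
      have : q * (q / V) ≤ q * L := mul_le_mul_of_nonneg_left hL1 hqp.le
      rw [← mul_div_assoc, hqq, mul_div_cancel_right₀ _ hV0.ne'] at this
      linarith
    have hdq : d ≤ q := Real.le_sqrt_of_sq_le (by nlinarith)
    have hVq : V ≤ √D * q := by
      rw [hq, ← Real.sqrt_mul hD]
      refine Real.le_sqrt_of_sq_le ?_
      have h3 : V * V ≤ V * (T * D) := mul_le_mul_of_nonneg_left hVT hV
      have h4 : V * (T * D) ≤ d * (V * (T * D)) := le_mul_of_one_le_left (by positivity) hd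
      nlinarith
    have hLV : L * V ≤ q + V := by
      have := mul_le_mul_of_nonneg_right hL2.le hV
      rwa [add_mul, div_mul_cancel₀ _ hV0.ne', one_mul] at this
    have h5 : c * (T / L * d) ≤ c * q := mul_le_mul_of_nonneg_left hTL hc
    have h6 : c * d ≤ c * q := mul_le_mul_of_nonneg_left hdq hc
    have h7 : G * (L * V) ≤ G * (q + √D * q) := mul_le_mul_of_nonneg_left (by linarith) hG
    calc R ≤ (2 * c + G * (1 + √D)) * q := by
          refine h1.trans ?_
          linarith
      _ ≤ _ := by
        gcongr
        exact le_max_left _ _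

end DynamicRegret

theorem theorem2 :
    ∃ k : ℕ, ∀ α G D : ℝ, 0 < α → 0 < G → 0 < D → ∃ C : ℝ,
      ∀ (n : ℕ) (S : Set (EuclideanSpace ℝ (Fin n))),
        Convex ℝ S → IsClosed S → (∀ x ∈ S, ∀ y ∈ S, ‖x - y‖ ≤ D) →
      ∀ (T : ℕ), 1 ≤ T →
      ∀ (f : ℕ → EuclideanSpace ℝ (Fin n) → ℝ)
        (grad : ℕ → EuclideanSpace ℝ (Fin n) → EuclideanSpace ℝ (Fin n)),
        (∀ t ∈ Finset.Icc 1 T, ∀ x ∈ S, HasGradientWithinAt (f t) (grad t x) S x) →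
        (∀ t ∈ Finset.Icc 1 T, ExpConcaveOn α S (f t) (grad t)) →
        (∀ t ∈ Finset.Icc 1 T, LossLipschitzOn G S (f t)) →
      ∀ x₁ : ℕ → EuclideanSpace ℝ (Fin n), (∀ j ∈ Finset.Icc 1 T, x₁ j ∈ S) →
      ∀ z : ℕ → EuclideanSpace ℝ (Fin n), (∀ t ∈ Finset.Icc 1 T, z t ∈ S) →
        dynamicRegret f (flhOns α G D S f grad x₁) z T ≤
          C * (1 + Real.log T) ^ k *
            max (Real.sqrt (Module.finrank ℝ (vectorSpan ℝ S) * T * pathVariation z T))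
              (Module.finrank ℝ (vectorSpan ℝ S)) := by
  refine ⟨1, fun α G D hα hG hD =>
    ⟨2 * (1 / α + 1 / onsRate α G D) + G * (1 + √D), ?_⟩⟩
  intro n S hconv hclosed hdiam T hT f grad hgrad hexp hlip x₁ hx₁ z hz
  have hS : IsCompact S := Metric.isCompact_of_isClosed_isBounded hclosed
    (Metric.isBounded_iff.2 ⟨D, fun x hx y hy => by simpa [dist_eq_norm] using hdiam x hx y hy⟩)
  rcases (Module.finrank ℝ (vectorSpan ℝ S)).eq_zero_or_pos with hdim | hdim
  · -- The decision set is a single point, and both sides vanish.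
    have hsub : ∀ x ∈ S, ∀ y ∈ S, x = y := fun x hx y hy => by
      have h := vsub_mem_vectorSpan ℝ hx hy
      rw [Submodule.finrank_eq_zero.1 hdim, Submodule.mem_bot, vsub_eq_sub, sub_eq_zero] at h
      exact h
    have h0 : dynamicRegret f (flhOns α G D S f grad x₁) z T = 0 :=
      Finset.sum_eq_zero fun t ht => by
        rw [hsub _ (flhOns_mem hconv hS hx₁ ht) _ (hz t ht), sub_self]
    simp [h0, hdim]
  · have hγ := onsRate_pos hα hG hD
    have hl : 1 ≤ 1 + Real.log T := by linarith [Real.log_natCast_nonneg T]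
    set d : ℝ := (Module.finrank ℝ (vectorSpan ℝ S) : ℝ) with hd
    have hc : 0 ≤ (1 / α + 1 / onsRate α G D) * (1 + Real.log T) := by positivity
    have hmain := le_max_of_forall_block_length hT rfl hc hG.le hD.le (pathVariation_nonneg z T)
      (pathVariation_le hD.le hdiam hz) (Nat.one_le_cast.2 hdim : (1 : ℝ) ≤ d)
      fun L hL => dynamicRegret_le_of_interval_regret hG.le (mul_nonneg hc (Nat.cast_nonneg _))
        hlip hz (fun r m hr hrT hm u hu =>
          flhOns_interval_regret hα hG hD hconv hS hdiam hdim hT hgrad hexp hlip hx₁ hr hrT hm hu)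
        hL le_rfl
    refine hmain.trans (mul_le_mul_of_nonneg_right ?_ (le_max_of_le_right (Nat.cast_nonneg _)))
    have h1 : G * (1 + √D) ≤ G * (1 + √D) * (1 + Real.log T) :=
      le_mul_of_one_le_right (by positivity) hl
    rw [pow_one]
    linarith
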